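/- Conventions. Scalars are real and $\mathbb N=\{1,2,3,\dots\}$. Let $X$ be a Banach space with a Schauder basis $(e_j)_{j\in\mathbb N}$; the support of $x=\sum_j x_je_j\in X$ is $\operatorname{supp}(x)=\{j : x_j\neq 0\}$. The Schreier family $S_1$ consists of $\emptyset$ and all finite non-empty sets $F\subset\mathbb N$ with $|F|\le\min F$. A finite sequence $(E_i)_{i=1}^n$ of finite non-empty subsets of $\mathbb N$ is $S_1$-allowable if the $E_i$ are pairwise disjoint and $\{\min E_i : 1\le i\le n\}\in S_1$. The space $X$ (with the given basis) is an asymptotic $\ell_2$ space for vectors with disjoint supports if there is a constant $C>0$ such that for every $n$ and all norm-one vectors $x_1,\dots,x_n\in X$ for which $(\operatorname{supp}(x_i))_{i=1}^n$ is $S_1$-allowable there are $A,B>0$ with $AB\le C$ and $$\frac1A\Big(\sum_{i=1}^n|a_i|^2\Big)^{1/2}\le\Big\|\sum_{i=1}^n a_ix_i\Big\|\le B\Big(\sum_{i=1}^n|a_i|^2\Big)^{1/2}\qquad\text{for all scalars }a_1,\dots,a_n.$$ For a finite-dimensional normed space $F$, let $d(F)$ be the Banach–Mazur distance from $F$ to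 $\ell_2^{\dim F}$, that is, the infimum of $\|T\|\,\|T^{-1}\|$ over all linear isomorphisms $T:F\to\ell_2^{\dim F}$. A Banach space $X$ is a weak Hilbert space if there are $\delta>0$ and $K\ge1$ such that every finite-dimensional subspace $E$ of $X$ contains a subspace $F\subseteq E$ with $\dim F\ge\delta\dim E$ and $d(F)\le K$ for which there is a linear projection $P$ of $X$ onto $F$ with $\|P\|\le K$. Theorem. If $X$ is an asymptotic $\ell_2$ space for vectors with disjoint supports, then $X$ is a weak Hilbert space. -/

import Mathlib

open scoped ENNReal

namespace WeakHilbert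

/-- The Schreier family `S₁`: the finite sets `F ⊆ {1, 2, 3, …}` that are empty or satisfy
`|F| ≤ min F`. (The condition excludes `0 ∈ F`, since then `1 ≤ |F| ≤ 0`.) -/
def schreierOne : Set (Finset ℕ) := {F | ∀ k ∈ F, F.card ≤ k}

/-- A finite sequence of sets of positive integers is `S₁`-allowable if the sets are finite,
non-empty and pairwise disjoint and the set of their minima belongs to `S₁`. -/
structure IsAllowable {n : ℕ} (E : Fin n → Set ℕ) : Prop where
  finite : ∀ i, (E i).Finite
  nonempty : ∀ i, (E i).Nonempty
  disjoint : ∀ i j, i ≠ j → Disjoint (E i) (E j)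
  minima : Finset.univ.image (fun i => sInf (E i)) ∈ schreierOne

variable {X : Type*} [NormedAddCommGroup X] [NormedSpace ℝ X]

/-- The support of `x` with respect to the basis `b`, a set of positive integers: the basis
vectors are numbered `e₁, e₂, …`, where `e_{j+1}` is the vector `b j`. -/
def supp (b : SchauderBasis ℝ X) (x : X) : Set ℕ :=
  {k | ∃ j : ℕ, k = j + 1 ∧ b.coord j x ≠ 0}

/-- The vectors `x₁, …, xₙ` are `C`-equivalent to the unit vector basis of `ℓ₂ⁿ`. -/
def IsEquivL2 (C : ℝ) {n : ℕ} (x : Fin n → X) : Prop :=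
  ∃ A B : ℝ, 0 < A ∧ 0 < B ∧ A * B ≤ C ∧ ∀ a : Fin n → ℝ,
    1 / A * √(∑ i, |a i| ^ 2) ≤ ‖∑ i, a i • x i‖ ∧
      ‖∑ i, a i • x i‖ ≤ B * √(∑ i, |a i| ^ 2)

/-- `X`, with the basis `b`, is an asymptotic `ℓ₂` space for vectors with disjoint supports,
with constant `C`: normalized vectors whose supports form an `S₁`-allowable sequence are
`C`-equivalent to the unit vector basis of `ℓ₂ⁿ`. -/
def IsAsymptoticL2DisjointWith (b : SchauderBasis ℝ X) (C : ℝ) : Prop :=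
  ∀ (n : ℕ) (x : Fin n → X), (∀ i, ‖x i‖ = 1) →
    IsAllowable (fun i => supp b (x i)) → IsEquivL2 C x

/-- `X`, with the basis `b`, is an asymptotic `ℓ₂` space for vectors with disjoint supports. -/
def IsAsymptoticL2Disjoint (b : SchauderBasis ℝ X) : Prop :=
  ∃ C : ℝ, 0 < C ∧ IsAsymptoticL2DisjointWith b C

/-- The Banach-Mazur distance of `F` to the Euclidean space `ℓ₂ⁿ`, `n = dim F`: the infimum of
`‖T‖ ‖T⁻¹‖` over all isomorphisms `T : F → ℓ₂ⁿ`. (It is `∞` if `F` is infinite-dimensional,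
as then no `T` exists.) -/
noncomputable def euclideanDist (F : Type*) [NormedAddCommGroup F] [NormedSpace ℝ F] : ℝ≥0∞ :=
  ⨅ T : F ≃L[ℝ] EuclideanSpace ℝ (Fin (Module.finrank ℝ F)),
    ‖(T : F →L[ℝ] EuclideanSpace ℝ (Fin (Module.finrank ℝ F)))‖ₑ *
      ‖(T.symm : EuclideanSpace ℝ (Fin (Module.finrank ℝ F)) →L[ℝ] F)‖ₑ

/-- `X` is a weak Hilbert space: every finite-dimensional subspace `E` contains a subspace `F`
of proportional dimension that is uniformly Euclidean and uniformly complemented in `X`. -/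
def IsWeakHilbert (X : Type*) [NormedAddCommGroup X] [NormedSpace ℝ X] : Prop :=
  ∃ δ C : ℝ, 0 < δ ∧ 1 ≤ C ∧
    ∀ E : Submodule ℝ X, FiniteDimensional ℝ E →
      ∃ F : Submodule ℝ X, F ≤ E ∧
        δ * (Module.finrank ℝ E : ℝ) ≤ (Module.finrank ℝ F : ℝ) ∧
        euclideanDist F ≤ ENNReal.ofReal C ∧
        ∃ P : X →L[ℝ] F, (∀ y : F, P (y : X) = y) ∧ ‖P‖ ≤ C

end WeakHilbert

namespace WeakHilbert

variable {X : Type*} [NormedAddCommGroup X] [NormedSpace ℝ X]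

/-! Blocks on `[n, ∞)` are `ℓ₂`-like by hypothesis when there are at most `n` of them. The number
can be raised exponentially: group blocks by the dyadic interval containing their minimum. Distinct
blocks have distinct minima, so at most `2 ^ t` blocks start in `[2 ^ t, 2 ^ (t + 1))`, and the
hypothesis applies inside each group as well as to the few groups. Two rounds (`IsPartitionL2.exp`)
allow doubly exponentially many blocks with constant `C ^ 3`.

Such numbers suffice to handle all of a `k`-dimensional space `E` in a tail. The basis is
unconditional off its first vector, so rounding the coordinates of an Auerbach basis of `E` places
`E` close to the span of at most `(2 * Q + 1) ^ k` disjoint vectors, with `Q` of order `k ^ 2`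
(`exists_approx_by_blocks`). Block projections followed by norming functionals give a bounded map of
`X` into a Hilbert space that is bounded below on that span, hence on `E`. So `E` is Euclidean, and
an orthogonal projection pulls back to a projection onto `E`.

A general `E` of dimension about `2 * m` is cut down to its vectors with vanishing first `m`
coordinates. At least half the dimension survives, and for large `m` the block count is below `2 ^
(2 ^ m - 1)`. Low dimensions are served by a line. -/

/-! ### Partitions into few blocks -/

/-- The vector `∑ j ∈ A, a j • b j`. -/
noncomputable def blockVec (b : SchauderBasis ℝ X) (a : ℕ → ℝ) (A : Finset ℕ) : X :=
  ∑ j ∈ A, a j • b j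

theorem coord_blockVec (b : SchauderBasis ℝ X) (a : ℕ → ℝ) (A : Finset ℕ) (j : ℕ) :
    b.coord j (blockVec b a A) = if j ∈ A then a j else 0 := by
  simp [blockVec, b.ortho, Pi.single_apply]

theorem sum_blockVec_fiber (b : SchauderBasis ℝ X) (a : ℕ → ℝ) (A : Finset ℕ)
    {ι : Type} [DecidableEq ι] (s : ℕ → ι) :
    ∑ i ∈ A.image s, blockVec b a (A.filter (s · = i)) = blockVec b a A :=
  Finset.sum_fiberwise_of_maps_to (fun _ hj => Finset.mem_image_of_mem s hj) _

/-- Blocks of vectors supported on `[n, ∞)` (in the numbering `e₁, e₂, …`), at most `M` of them,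
behave with constant `K` like orthogonal vectors. The blocks are the fibres of a labelling `s`. -/
def IsPartitionL2 (b : SchauderBasis ℝ X) (n M : ℕ) (K : ℝ) : Prop :=
  ∀ (ι : Type) [DecidableEq ι] (a : ℕ → ℝ) (A : Finset ℕ) (s : ℕ → ι),
    (∀ j ∈ A, n ≤ j + 1) → (A.image s).card ≤ M →
      ∑ i ∈ A.image s, ‖blockVec b a (A.filter (s · = i))‖ ^ 2 ≤ K ^ 2 * ‖blockVec b a A‖ ^ 2 ∧
      ‖blockVec b a A‖ ^ 2 ≤ K ^ 2 * ∑ i ∈ A.image s, ‖blockVec b a (A.filter (s · = i))‖ ^ 2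

theorem IsEquivL2.sq_bounds {C : ℝ} {n : ℕ} {x : Fin n → X} (hx : ∀ i, ‖x i‖ = 1)
    (h : IsEquivL2 C x) (a : Fin n → ℝ) :
    ∑ i, a i ^ 2 ≤ C ^ 2 * ‖∑ i, a i • x i‖ ^ 2 ∧
      ‖∑ i, a i • x i‖ ^ 2 ≤ C ^ 2 * ∑ i, a i ^ 2 := by
  obtain ⟨A, B, hA, hB, hAB, h⟩ := h
  rcases Nat.eq_zero_or_pos n with rfl | hn
  · simp
  -- Testing on one unit vector gives `A, B ≥ 1`, so `A * B ≤ C` bounds each of them by `C`.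
  obtain ⟨h1, h2⟩ := h (Pi.single ⟨0, hn⟩ 1)
  have e1 : ∑ i, |(Pi.single ⟨0, hn⟩ 1 : Fin n → ℝ) i| ^ 2 = 1 := by
    rw [Finset.sum_eq_single ⟨0, hn⟩] <;> simp +contextual
  have e2 : ∑ i, (Pi.single ⟨0, hn⟩ 1 : Fin n → ℝ) i • x i = x ⟨0, hn⟩ := by
    rw [Finset.sum_eq_single ⟨0, hn⟩] <;> simp +contextual
  rw [e1, e2, hx, Real.sqrt_one, mul_one] at h1 h2
  have hA1 : 1 ≤ A := by rwa [div_le_one hA] at h1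
  have hB1 : 1 ≤ B := by simpa using h2
  have hAC : A ≤ C := by nlinarith
  have hBC : B ≤ C := by nlinarith
  obtain ⟨h1, h2⟩ := h a
  simp only [sq_abs] at h1 h2
  have hs : 0 ≤ ∑ i, a i ^ 2 := Finset.sum_nonneg fun i _ => sq_nonneg _
  have hr := Real.sqrt_nonneg (∑ i, a i ^ 2)
  have hN := norm_nonneg (∑ i, a i • x i)
  rw [← Real.sq_sqrt hs, ← mul_pow, ← mul_pow]
  constructor
  · refine pow_le_pow_left₀ hr ?_ 2
    rw [one_div, inv_mul_le_iff₀ hA] at h1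
    exact h1.trans (by gcongr)
  · exact pow_le_pow_left₀ hN (h2.trans (by gcongr)) 2

theorem supp_smul_blockVec (b : SchauderBasis ℝ X) (a : ℕ → ℝ) (A : Finset ℕ) {r : ℝ}
    (hr : r ≠ 0) : supp b (r • blockVec b a A) = {k | ∃ j ∈ A, k = j + 1 ∧ a j ≠ 0} := by
  ext k
  simp only [supp, map_smul, coord_blockVec, Set.mem_ofPred_eq, smul_eq_mul]
  constructor
  · rintro ⟨j, rfl, h⟩
    by_cases hj : j ∈ A
    · exact ⟨j, hj, rfl, by simpa [hj, hr] using h⟩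
    · simp [hj] at h
  · rintro ⟨j, hj, rfl, h⟩
    exact ⟨j, rfl, by simp [hj, hr, h]⟩

theorem IsAsymptoticL2DisjointWith.isPartitionL2 {b : SchauderBasis ℝ X} {C : ℝ}
    (h : IsAsymptoticL2DisjointWith b C) (n : ℕ) : IsPartitionL2 b n n C := by
  intro ι _ a A s hA hcard
  classical
  set v : ι → X := fun i => blockVec b a (A.filter (s · = i)) with hv
  set I := (A.image s).filter (fun i => v i ≠ 0) with hI
  let e := I.equivFin.symm
  have hne : ∀ k, ‖v (e k)‖ ≠ 0 := fun k =>
    norm_ne_zero_iff.2 (Finset.mem_filter.1 (e k).2).2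
  let x : Fin I.card → X := fun k => ‖v (e k)‖⁻¹ • v (e k)
  have hx : ∀ k, ‖x k‖ = 1 := fun k => by
    simp [x, norm_smul, inv_mul_cancel₀ (hne k)]
  have hsupp : ∀ k, supp b (x k) =
      {l | ∃ j ∈ A.filter (s · = (e k : ι)), l = j + 1 ∧ a j ≠ 0} := fun k =>
    supp_smul_blockVec b a _ (inv_ne_zero (hne k))
  have hnonempty : ∀ k, (supp b (x k)).Nonempty := by
    intro k
    by_contra hc
    rw [hsupp, Set.not_nonempty_iff_eq_empty, Set.eq_empty_iff_forall_notMem] at hc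
    refine hne k (norm_eq_zero.2 (Finset.sum_eq_zero fun j hj => ?_))
    by_cases haj : a j = 0
    · simp [haj]
    · exact absurd ⟨j, hj, rfl, haj⟩ (hc (j + 1))
  have hallow : IsAllowable (fun k => supp b (x k)) := by
    refine ⟨fun k => ?_, hnonempty, fun k l hkl => ?_, ?_⟩
    · rw [hsupp]
      refine (A.image (· + 1)).finite_toSet.subset ?_
      rintro _ ⟨j, hj, rfl, -⟩
      exact Finset.mem_coe.2 (Finset.mem_image_of_mem _ (Finset.mem_filter.1 hj).1)
    · rw [hsupp, hsupp, Set.disjoint_left]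
      rintro _ ⟨j, hj, rfl, -⟩ ⟨j', hj', hjj, -⟩
      obtain rfl : j = j' := by omega
      exact hkl (e.injective (Subtype.ext
        ((Finset.mem_filter.1 hj).2.symm.trans (Finset.mem_filter.1 hj').2)))
    · intro m hm
      obtain ⟨k, -, rfl⟩ := Finset.mem_image.1 hm
      have hmem := Nat.sInf_mem (hnonempty k)
      generalize sInf (supp b (x k)) = q at *
      rw [hsupp] at hmem
      obtain ⟨j, hj, rfl, -⟩ := hmem
      calc _ ≤ (Finset.univ : Finset (Fin I.card)).card := Finset.card_image_le
        _ ≤ n := by simpa using (Finset.card_filter_le _ _).trans hcard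
        _ ≤ j + 1 := hA j (Finset.mem_filter.1 hj).1
  have key := (h _ x hx hallow).sq_bounds hx (fun k => ‖v (e k)‖)
  have e1 : ∑ k, ‖v (e k)‖ • x k = blockVec b a A := by
    rw [← sum_blockVec_fiber b a A s]
    calc _ = ∑ k, v (e k) := Finset.sum_congr rfl fun k _ => by
            simp only [x, smul_smul, mul_inv_cancel₀ (hne k), one_smul]
      _ = ∑ i : I, v i := e.sum_comp (fun i => v i)
      _ = ∑ i ∈ I, v i := Finset.sum_coe_sort I v
      _ = _ := Finset.sum_filter_ne_zero _
  have e2 : ∑ k, ‖v (e k)‖ ^ 2 = ∑ i ∈ A.image s, ‖v i‖ ^ 2 := by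
    calc _ = ∑ i : I, ‖v i‖ ^ 2 := e.sum_comp (fun i => ‖v i‖ ^ 2)
      _ = ∑ i ∈ I, ‖v i‖ ^ 2 := Finset.sum_coe_sort I (fun i => ‖v i‖ ^ 2)
      _ = _ := by
        refine Finset.sum_filter_of_ne fun i _ hi => ?_
        contrapose! hi
        simp [hi]
  rw [e1, e2] at key
  exact key

/-! ### Raising the number of blocks -/

/-- The label `s` refines `τ ∘ s`, so cutting a coarse fibre by `s` produces whole fibres of `s`,
each once. -/
theorem sum_fiber_comp {ι κ : Type} [DecidableEq ι] [DecidableEq κ] (A : Finset ℕ) (s : ℕ → ι)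
    (τ : ι → κ) (f : Finset ℕ → ℝ) :
    ∑ t ∈ A.image (τ ∘ s), ∑ i ∈ (A.filter ((τ ∘ s) · = t)).image s,
        f ((A.filter ((τ ∘ s) · = t)).filter (s · = i)) =
      ∑ i ∈ A.image s, f (A.filter (s · = i)) := by
  rw [← Finset.sum_fiberwise_of_maps_to (s := A.image s) (t := A.image (τ ∘ s)) (g := τ)]
  · refine Finset.sum_congr rfl fun t _ => ?_
    have e : (A.filter ((τ ∘ s) · = t)).image s = (A.image s).filter (τ · = t) := by
      ext i
      simp only [Finset.mem_image, Finset.mem_filter, Function.comp]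
      grind
    rw [e]
    refine Finset.sum_congr rfl fun i hi => ?_
    congr 1
    ext j
    simp only [Finset.mem_filter, Function.comp] at hi ⊢
    grind
  · intro i hi
    obtain ⟨j, hj, rfl⟩ := Finset.mem_image.1 hi
    exact Finset.mem_image_of_mem (τ ∘ s) hj

/-- Grouping the blocks by the size of their minima passes from `T + 1` blocks to `2 ^ T`. -/
theorem IsPartitionL2.exp {b : SchauderBasis ℝ X} {n T : ℕ} {C K : ℝ}
    (hC : ∀ t, IsPartitionL2 b (2 ^ t) (2 ^ t) C) (hK : IsPartitionL2 b n (T + 1) K) :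
    IsPartitionL2 b n (2 ^ T) (K * C) := by
  intro ι _ a A s hA hcard
  let m : ι → ℕ := fun i => sInf {k | ∃ j ∈ A, s j = i ∧ k = j + 1}
  have hm_mem : ∀ i ∈ A.image s, ∃ j ∈ A, s j = i ∧ m i = j + 1 := by
    intro i hi
    obtain ⟨j, hj, hji⟩ := Finset.mem_image.1 hi
    exact Nat.sInf_mem (s := {k | ∃ j ∈ A, s j = i ∧ k = j + 1}) ⟨j + 1, j, hj, hji, rfl⟩
  have hm_le : ∀ j ∈ A, m (s j) ≤ j + 1 := fun j hj => Nat.sInf_le ⟨j, hj, rfl, rfl⟩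
  -- The cap at `T` keeps the number of groups at `T + 1`; the last group collects every block with
  -- minimum at least `2 ^ T`.
  let τ : ι → ℕ := fun i => min (Nat.log 2 (m i)) T
  have h1 := hK ℕ a A (τ ∘ s) hA (by
    calc _ ≤ (Finset.range (T + 1)).card := Finset.card_le_card (by
            intro t ht
            obtain ⟨j, -, rfl⟩ := Finset.mem_image.1 ht
            simp only [Finset.mem_range, Function.comp, τ]
            omega)
      _ = T + 1 := Finset.card_range _)
  have h2 : ∀ t ∈ A.image (τ ∘ s), _ := fun t _ =>
    hC t ι a (A.filter ((τ ∘ s) · = t)) s (by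
      intro j hj
      obtain ⟨hjA, rfl⟩ := Finset.mem_filter.1 hj
      obtain ⟨j', -, -, hj'⟩ := hm_mem _ (Finset.mem_image_of_mem s hjA)
      refine le_trans (Nat.pow_le_of_le_log (by omega) ?_) (hm_le j hjA)
      exact min_le_left _ _) (by
      rcases lt_or_ge t T with htT | htT
      · calc _ ≤ (Finset.Ico (2 ^ t) (2 ^ (t + 1))).card := by
              refine Finset.card_le_card_of_injOn m ?_ ?_
              · intro i hi
                obtain ⟨j, hj, rfl⟩ := Finset.mem_image.1 (Finset.mem_coe.1 hi)
                obtain ⟨hjA, hjt⟩ := Finset.mem_filter.1 hj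
                obtain ⟨j', -, -, hj'⟩ := hm_mem _ (Finset.mem_image_of_mem s hjA)
                have hlog : Nat.log 2 (m (s j)) = t := by
                  simp only [Function.comp, τ] at hjt
                  omega
                rw [Finset.coe_Ico, Set.mem_Ico]
                exact (Nat.log_eq_iff (Or.inr ⟨by norm_num, by omega⟩)).1 hlog
              · intro i hi i' hi' hii
                have hsub : ∀ i, i ∈ (A.filter ((τ ∘ s) · = t)).image s → i ∈ A.image s :=
                  fun i hi => Finset.image_subset_image (Finset.filter_subset _ _) hi
                obtain ⟨j, -, rfl, hj⟩ := hm_mem i (hsub _ hi)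
                obtain ⟨j', -, rfl, hj'⟩ := hm_mem i' (hsub _ hi')
                obtain rfl : j = j' := by omega
                rfl
          _ = 2 ^ t := by rw [Nat.card_Ico, pow_succ]; omega
      -- In the capped group the bound on the total number of blocks is enough.
      · calc _ ≤ (A.image s).card :=
              Finset.card_le_card (Finset.image_subset_image (Finset.filter_subset _ _))
          _ ≤ 2 ^ T := hcard
          _ ≤ 2 ^ t := Nat.pow_le_pow_right (by norm_num) htT)
  have e := sum_fiber_comp A s τ (fun B => ‖blockVec b a B‖ ^ 2)
  have h3 := Finset.sum_le_sum fun t ht => (h2 t ht).1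
  have h4 := Finset.sum_le_sum fun t ht => (h2 t ht).2
  rw [← Finset.mul_sum] at h3 h4
  rw [e] at h3 h4
  constructor
  · calc _ ≤ _ := h3
      _ ≤ C ^ 2 * _ := mul_le_mul_of_nonneg_left h1.1 (sq_nonneg C)
      _ = _ := by ring
  · calc _ ≤ _ := h1.2
      _ ≤ K ^ 2 * _ := mul_le_mul_of_nonneg_left h4 (sq_nonneg K)
      _ = _ := by ring

theorem IsAsymptoticL2DisjointWith.isPartitionL2_exp_exp {b : SchauderBasis ℝ X} {C : ℝ}
    (h : IsAsymptoticL2DisjointWith b C) {n : ℕ} (hn : 1 ≤ n) :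
    IsPartitionL2 b n (2 ^ (2 ^ (n - 1) - 1)) (C ^ 3) := by
  have h1 : IsPartitionL2 b n (n - 1 + 1) C := by
    rw [Nat.sub_add_cancel hn]
    exact h.isPartitionL2 n
  have h2 := IsPartitionL2.exp (fun t => h.isPartitionL2 _) h1
  -- Written as a successor, the count `2 ^ (n - 1)` can be fed to `IsPartitionL2.exp` again.
  rw [← Nat.sub_add_cancel (Nat.one_le_two_pow : 1 ≤ 2 ^ (n - 1))] at h2
  have h3 := IsPartitionL2.exp (fun t => h.isPartitionL2 _) h2
  rwa [show C * C * C = C ^ 3 by ring] at h3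

/-! ### Unconditionality off the first basis vector -/

theorem IsPartitionL2.norm_fiber_le {b : SchauderBasis ℝ X} {n M : ℕ} {K : ℝ}
    (h : IsPartitionL2 b n M K) (hK : 0 ≤ K) {ι : Type} [DecidableEq ι] (a : ℕ → ℝ)
    {A : Finset ℕ} (s : ℕ → ι) (hA : ∀ j ∈ A, n ≤ j + 1) (hs : (A.image s).card ≤ M) (i : ι) :
    ‖blockVec b a (A.filter (s · = i))‖ ≤ K * ‖blockVec b a A‖ := by
  by_cases hi : i ∈ A.image s
  · refine le_of_sq_le_sq ?_ (by positivity)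
    rw [mul_pow]
    exact (Finset.single_le_sum (f := fun i => ‖blockVec b a (A.filter (s · = i))‖ ^ 2)
      (fun _ _ => sq_nonneg _) hi).trans (h ι a A s hA hs).1
  · have : A.filter (s · = i) = ∅ := by
      refine Finset.filter_eq_empty_iff.2 fun j hj hji => hi ?_
      exact hji ▸ Finset.mem_image_of_mem s hj
    rw [this]
    simp only [blockVec, Finset.sum_empty, norm_zero]
    positivity

/-- `A` and `B \ A` are the two fibres of a Boolean label. Index `0` is excluded because two blocks
are allowable only from `e₂` on. -/
theorem IsPartitionL2.norm_blockVec_subset_le {b : SchauderBasis ℝ X} {C : ℝ}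
    (h : IsPartitionL2 b 2 2 C) (hC : 0 ≤ C) (a : ℕ → ℝ) {A B : Finset ℕ} (hAB : A ⊆ B)
    (hB : ∀ j ∈ B, 1 ≤ j) : ‖blockVec b a A‖ ≤ C * ‖blockVec b a B‖ := by
  have := h.norm_fiber_le hC a (fun j => decide (j ∈ A)) (A := B)
    (fun j hj => by have := hB j hj; omega)
    ((Finset.card_le_univ _).trans (by simp)) true
  rwa [show B.filter (fun j => decide (j ∈ A) = true) = A by ext j; simpa using @hAB j] at this

/-- A sum with coefficients in `[0, 1]` is bounded by the subset sums. -/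
theorem norm_sum_smul_le_of_subset_sums {ι : Type*} (u : ι → X) (θ : ι → ℝ) (B : Finset ι)
    (hθ : ∀ j ∈ B, 0 ≤ θ j ∧ θ j ≤ 1) {R : ℝ} (w : X)
    (h : ∀ A ⊆ B, ‖w + ∑ j ∈ A, u j‖ ≤ R) : ‖w + ∑ j ∈ B, θ j • u j‖ ≤ R := by
  classical
  induction B using Finset.induction_on generalizing w with
  | empty => simpa using h ∅ subset_rfl
  | insert i B hi ih =>
    have h0 := ih (fun j hj => hθ j (Finset.mem_insert_of_mem hj)) w fun A hA =>
      h A (hA.trans (Finset.subset_insert _ _))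
    have h1 := ih (fun j hj => hθ j (Finset.mem_insert_of_mem hj)) (w + u i) fun A hA => by
      have := h (insert i A) (Finset.insert_subset_insert i hA)
      rwa [Finset.sum_insert (fun hh => hi (hA hh)), ← add_assoc] at this
    obtain ⟨ht0, ht1⟩ := hθ i (Finset.mem_insert_self _ _)
    rw [Finset.sum_insert hi]
    have e : w + (θ i • u i + ∑ j ∈ B, θ j • u j) =
        (1 - θ i) • (w + ∑ j ∈ B, θ j • u j) + θ i • (w + u i + ∑ j ∈ B, θ j • u j) := by
      module
    rw [e]
    refine (norm_add_le _ _).trans ?_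
    rw [norm_smul, norm_smul, Real.norm_of_nonneg (sub_nonneg.2 ht1), Real.norm_of_nonneg ht0]
    nlinarith

/-- The multipliers `a' j / a j` lie in `[-1, 1]`; their positive and negative parts each cost a
factor `C`. -/
theorem IsPartitionL2.norm_blockVec_le_of_abs_le {b : SchauderBasis ℝ X} {C : ℝ}
    (h : IsPartitionL2 b 2 2 C) (hC : 0 ≤ C) {a a' : ℕ → ℝ} {B : Finset ℕ}
    (hB : ∀ j ∈ B, 1 ≤ j) (ha : ∀ j ∈ B, |a' j| ≤ |a j|) :
    ‖blockVec b a' B‖ ≤ 2 * C * ‖blockVec b a B‖ := by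
  have key : ∀ θ : ℕ → ℝ, (∀ j ∈ B, 0 ≤ θ j ∧ θ j ≤ 1) →
      ‖∑ j ∈ B, θ j • (a j • b j)‖ ≤ C * ‖blockVec b a B‖ := by
    intro θ hθ
    have := norm_sum_smul_le_of_subset_sums (fun j => a j • b j) θ B hθ 0
      (R := C * ‖blockVec b a B‖) fun A hA => by
        rw [zero_add]; exact h.norm_blockVec_subset_le hC a hA hB
    rwa [zero_add] at this
  have hq : ∀ j ∈ B, |a' j / a j| ≤ 1 := fun j hj => by
    rw [abs_div]; exact div_le_one_of_le₀ (ha j hj) (abs_nonneg _)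
  have h1 := key (fun j => max (a' j / a j) 0) fun j hj =>
    ⟨le_max_right _ _, max_le (abs_le.1 (hq j hj)).2 zero_le_one⟩
  have h2 := key (fun j => max (-(a' j / a j)) 0) fun j hj =>
    ⟨le_max_right _ _, max_le (by linarith [(abs_le.1 (hq j hj)).1]) zero_le_one⟩
  have e : blockVec b a' B = ∑ j ∈ B, max (a' j / a j) 0 • (a j • b j) -
      ∑ j ∈ B, max (-(a' j / a j)) 0 • (a j • b j) := by
    rw [← Finset.sum_sub_distrib]
    refine Finset.sum_congr rfl fun j hj => ?_
    have hm : ∀ r : ℝ, max r 0 - max (-r) 0 = r := fun r => by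
      rcases le_total r 0 with hr | hr
      · rw [max_eq_right hr, max_eq_left (by linarith)]; ring
      · rw [max_eq_left hr, max_eq_right (by linarith)]; ring
    rw [← sub_smul, hm, smul_smul]
    congr 1
    by_cases haj : a j = 0
    · have := ha j hj
      rw [haj, abs_zero] at this
      simp [abs_nonpos_iff.1 this]
    · field_simp
  rw [e]
  refine (norm_sub_le _ _).trans ?_
  linarith

theorem IsPartitionL2.exists_norm_proj_le {b : SchauderBasis ℝ X} {C : ℝ}
    (h : IsPartitionL2 b 2 2 C) (hC : 0 ≤ C) : ∃ D : ℝ, 1 ≤ D ∧ ∀ A : Finset ℕ,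
      (∀ j ∈ A, 1 ≤ j) → ∀ x : X, ‖GeneralSchauderBasis.proj b A x‖ ≤ D * ‖x‖ := by
  -- The first coordinate is removed by hand, at the cost `1 + ‖b.coord 0‖ * ‖b 0‖`; the subset
  -- bound for partial sums then passes to the limit.
  refine ⟨max 1 (C * (1 + ‖b.coord 0‖ * ‖b 0‖)), le_max_left _ _, fun A hA x => ?_⟩
  have hlim : Filter.Tendsto (fun n => C * ‖SchauderBasis.proj b n x - b.coord 0 x • b 0‖)
      Filter.atTop (nhds (C * ‖x - b.coord 0 x • b 0‖)) :=
    (((SchauderBasis.tendsto_proj b x).sub_const _).norm).const_mul C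
  have hle : ‖GeneralSchauderBasis.proj b A x‖ ≤ C * ‖x - b.coord 0 x • b 0‖ := by
    refine ge_of_tendsto hlim ?_
    filter_upwards [Filter.eventually_gt_atTop (A.sup id)] with n hn
    have e : SchauderBasis.proj b n x - b.coord 0 x • b 0 =
        blockVec b (fun j => b.coord j x) ((Finset.range n).erase 0) := by
      rw [SchauderBasis.proj_apply, blockVec,
        ← Finset.add_sum_erase _ _ (Finset.mem_range.2 (Nat.zero_lt_of_lt hn))]
      abel
    rw [e, GeneralSchauderBasis.proj_apply]
    refine h.norm_blockVec_subset_le hC _ (fun j hj => ?_) fun j hj => ?_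
    · have := Finset.le_sup (f := id) hj
      have := hA j hj
      simp only [id] at *
      exact Finset.mem_erase.2 ⟨by omega, Finset.mem_range.2 (by omega)⟩
    · have := (Finset.mem_erase.1 hj).1
      omega
  refine hle.trans ?_
  have h1 : ‖x - b.coord 0 x • b 0‖ ≤ (1 + ‖b.coord 0‖ * ‖b 0‖) * ‖x‖ := by
    refine (norm_sub_le _ _).trans ?_
    rw [norm_smul]
    have := mul_le_mul_of_nonneg_right ((b.coord 0).le_opNorm x) (norm_nonneg (b 0))
    linarith
  calc _ ≤ C * ((1 + ‖b.coord 0‖ * ‖b 0‖) * ‖x‖) := by gcongr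
    _ = (C * (1 + ‖b.coord 0‖ * ‖b 0‖)) * ‖x‖ := by ring
    _ ≤ _ := by gcongr; exact le_max_right _ _

/-! ### Operators into a Hilbert space -/

/-- A subspace on which a bounded operator into a Hilbert space is bounded below is Euclidean and
complemented. -/
theorem euclideanDist_le_and_exists_projection {H : Type*} [NormedAddCommGroup H]
    [InnerProductSpace ℝ H] (V : X →L[ℝ] H) {α β : ℝ} (hα : 0 ≤ α) (hβ : 0 ≤ β)
    (hV : ∀ x, ‖V x‖ ≤ α * ‖x‖) (E : Submodule ℝ X) [FiniteDimensional ℝ E]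
    (hE : ∀ x ∈ E, ‖x‖ ≤ β * ‖V x‖) :
    euclideanDist E ≤ ENNReal.ofReal (α * β) ∧
      ∃ P : X →L[ℝ] E, (∀ y : E, P (y : X) = y) ∧ ‖P‖ ≤ α * β := by
  let W : E →ₗ[ℝ] H := (V : X →ₗ[ℝ] H).domRestrict E
  have hWV : ∀ x : E, W x = V x := fun x => rfl
  have hinj : Function.Injective W := by
    rw [injective_iff_map_eq_zero]
    intro x hx
    have := hE x x.2
    rw [← hWV, hx, norm_zero, mul_zero] at this
    exact norm_le_zero_iff.1 this
  let L : E ≃L[ℝ] LinearMap.range W := (LinearEquiv.ofInjective W hinj).toContinuousLinearEquiv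
  have hL : ∀ x : E, ((L x : LinearMap.range W) : H) = V x := fun x => rfl
  have hLsymm : ∀ g, ‖L.symm g‖ ≤ β * ‖g‖ := by
    intro g
    obtain ⟨x, rfl⟩ := L.surjective g
    rw [L.symm_apply_apply]
    exact hE x x.2
  constructor
  · have hdim : Module.finrank ℝ (LinearMap.range W) = Module.finrank ℝ E :=
      L.toLinearEquiv.finrank_eq.symm
    let J := ((stdOrthonormalBasis ℝ (LinearMap.range W)).reindex (finCongr hdim)).repr
    let T : E ≃L[ℝ] EuclideanSpace ℝ (Fin (Module.finrank ℝ E)) :=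
      L.trans J.toContinuousLinearEquiv
    have hT : ∀ x : E, ‖T x‖ = ‖V x‖ := fun x => by
      rw [← hL]
      exact J.norm_map (L x)
    have hTsymm : ∀ y, ‖T.symm y‖ ≤ β * ‖y‖ := fun y => by
      have := hLsymm (J.symm y)
      rwa [J.symm.norm_map] at this
    refine (iInf_le _ T).trans ?_
    rw [ENNReal.ofReal_mul hα]
    gcongr
    · rw [← ofReal_norm]
      refine ENNReal.ofReal_le_ofReal (ContinuousLinearMap.opNorm_le_bound _ hα fun x => ?_)
      exact (hT x).trans_le (hV x)
    · rw [← ofReal_norm]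
      exact ENNReal.ofReal_le_ofReal (ContinuousLinearMap.opNorm_le_bound _ hβ hTsymm)
  -- The projection is `V`, then orthogonal projection onto `V E`, then the inverse of `V` on `E`.
  · let R := (LinearMap.range W).orthogonalProjectionOnto
    refine ⟨(L.symm : LinearMap.range W →L[ℝ] E) ∘L R ∘L V, fun y => ?_, ?_⟩
    · change L.symm (R (V y)) = y
      rw [← hL, Submodule.orthogonalProjectionOnto_mem_subspace_eq_self, L.symm_apply_apply]
    · refine ContinuousLinearMap.opNorm_le_bound _ (mul_nonneg hα hβ) fun x => ?_
      calc ‖L.symm (R (V x))‖ ≤ β * ‖R (V x)‖ := hLsymm _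
        _ ≤ β * ‖V x‖ := by
          gcongr
          exact Submodule.norm_orthogonalProjectionOnto_apply_le _ _
        _ ≤ β * (α * ‖x‖) := by gcongr; exact hV x
        _ = _ := by ring

/-! ### Auerbach bases -/

/-- Expansion of a determinant after replacing one vector of a basis. -/
theorem det_update_basis {ι E : Type*} [Fintype ι] [DecidableEq ι] [AddCommGroup E] [Module ℝ E]
    (e x : Module.Basis ι ℝ E) (i : ι) (y : E) :
    e.det (Function.update x i y) = x.repr y i * e.det x := by
  conv_lhs => rw [← x.sum_repr y]
  rw [AlternatingMap.map_update_sum, Finset.sum_eq_single i]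
  · rw [AlternatingMap.map_update_smul, Function.update_eq_self, smul_eq_mul]
  · intro j _ hj
    rw [AlternatingMap.map_update_smul, AlternatingMap.map_update_self _ _ hj.symm, smul_zero]
  · simp

/-- Auerbach's lemma. -/
theorem exists_auerbach_basis (E : Type*) [NormedAddCommGroup E] [NormedSpace ℝ E]
    [FiniteDimensional ℝ E] : ∃ x : Module.Basis (Fin (Module.finrank ℝ E)) ℝ E,
      (∀ i, ‖x i‖ ≤ 1) ∧ ∀ y i, |x.repr y i| ≤ ‖y‖ := by
  let e := Module.finBasis ℝ E
  have : ProperSpace E := FiniteDimensional.proper ℝ E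
  have hcont : Continuous fun x : Fin (Module.finrank ℝ E) → E => |e.det x| := by
    refine Continuous.abs ?_
    change Continuous fun x : Fin (Module.finrank ℝ E) → E => (e.toMatrix x).det
    refine Continuous.matrix_det (continuous_matrix fun i j => ?_)
    exact ((e.coord i).continuous_of_finiteDimensional).comp (continuous_apply j)
  obtain ⟨x, hx, hmax⟩ := (isCompact_closedBall (0 : Fin (Module.finrank ℝ E) → E) 1).exists_isMaxOn
    ⟨0, Metric.mem_closedBall_self zero_le_one⟩ hcont.continuousOn
  have hx1 : ∀ i, ‖x i‖ ≤ 1 := fun i =>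
    (norm_le_pi_norm x i).trans (by simpa using hx)
  have hmax' : ∀ z : Fin (Module.finrank ℝ E) → E, (∀ i, ‖z i‖ ≤ 1) → |e.det z| ≤ |e.det x| := by
    intro z hz
    refine hmax ?_
    rw [mem_closedBall_zero_iff]
    exact (pi_norm_le_iff_of_nonneg zero_le_one).2 hz
  have hne : ∀ i, ‖e i‖ ≠ 0 := fun i => norm_ne_zero_iff.2 (e.ne_zero i)
  have hpos : 0 < |e.det x| := by
    refine lt_of_lt_of_le ?_ (hmax' (fun i => ‖e i‖⁻¹ • e i) fun i => ?_)
    · rw [AlternatingMap.map_smul_univ, e.det_self, abs_pos]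
      simpa [Finset.prod_eq_zero_iff] using fun i => e.ne_zero i
    · rw [norm_smul, norm_inv, norm_norm, inv_mul_cancel₀ (hne i)]
  obtain ⟨hli, hsp⟩ := e.is_basis_iff_det.2 (isUnit_iff_ne_zero.2 (abs_pos.1 hpos))
  let x' := Module.Basis.mk hli hsp.ge
  have hx' : (x' : Fin (Module.finrank ℝ E) → E) = x := Module.Basis.coe_mk _ _
  refine ⟨x', fun i => hx' ▸ hx1 i, fun y i => ?_⟩
  rcases eq_or_ne y 0 with rfl | hy
  · simp
  have hy' : 0 < ‖y‖ := norm_pos_iff.2 hy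
  -- Putting `y / ‖y‖` in place of `x i` multiplies the maximal determinant by the `i`-th coordinate
  -- of `y / ‖y‖`, which is therefore at most `1` in absolute value.
  have h1 := hmax' (Function.update x i (‖y‖⁻¹ • y)) fun j => by
    rcases eq_or_ne j i with rfl | hj
    · rw [Function.update_self, norm_smul, norm_inv, norm_norm, inv_mul_cancel₀ hy'.ne']
    · rw [Function.update_of_ne hj]
      exact hx1 j
  rw [← hx', det_update_basis, abs_mul, hx', mul_le_iff_le_one_left hpos, map_smul,
    Finsupp.smul_apply, smul_eq_mul, abs_mul, abs_inv, abs_norm, inv_mul_le_iff₀ hy', mul_one] at h1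
  exact h1

/-! ### Approximation by disjoint vectors -/

theorem blockVec_smul (b : SchauderBasis ℝ X) (r : ℝ) (a : ℕ → ℝ) (A : Finset ℕ) :
    blockVec b (fun j => r * a j) A = r • blockVec b a A := by
  simp [blockVec, Finset.smul_sum, smul_smul]

theorem blockVec_sub (b : SchauderBasis ℝ X) (a a' : ℕ → ℝ) (A : Finset ℕ) :
    blockVec b (fun j => a j - a' j) A = blockVec b a A - blockVec b a' A := by
  simp [blockVec, sub_smul]

theorem blockVec_sum (b : SchauderBasis ℝ X) {κ : Type*} (S : Finset κ) (a : κ → ℕ → ℝ)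
    (A : Finset ℕ) : blockVec b (fun j => ∑ i ∈ S, a i j) A = ∑ i ∈ S, blockVec b (a i) A := by
  simp only [blockVec, Finset.sum_smul]
  exact Finset.sum_comm

/-- A finite-dimensional space of vectors supported on a tail is close to the span of few
disjointly supported vectors. -/
theorem exists_approx_by_blocks {b : SchauderBasis ℝ X} {C D η : ℝ} {n Q : ℕ}
    (h : IsPartitionL2 b 2 2 C) (hC : 0 ≤ C) (hn : 2 ≤ n) (hQ : 0 < Q) (hη : 0 < η)
    (hD : ∀ A : Finset ℕ, (∀ j ∈ A, 1 ≤ j) →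
      ∀ x : X, ‖GeneralSchauderBasis.proj b A x‖ ≤ D * ‖x‖)
    (E : Submodule ℝ X) [FiniteDimensional ℝ E] (hE : ∀ x ∈ E, ∀ j, j + 1 < n → b.coord j x = 0)
    (hQη : 4 * C ^ 2 * D * Module.finrank ℝ E ^ 2 / Q ≤ η / 2) :
    ∃ (A : Finset ℕ) (ρ : ℕ → ℝ) (s : ℕ → Fin (Module.finrank ℝ E) → ℤ),
      (∀ j ∈ A, n ≤ j + 1) ∧ (A.image s).card ≤ (2 * Q + 1) ^ Module.finrank ℝ E ∧
      ∀ x ∈ E, ∃ c : (Fin (Module.finrank ℝ E) → ℤ) → ℝ,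
        ‖x - blockVec b (fun j => ρ j * c (s j)) A‖ ≤ η * ‖x‖ := by
  have hauer := exists_auerbach_basis E
  generalize Module.finrank ℝ E = k at hauer hQη ⊢
  obtain ⟨x, hx1, hxr⟩ := hauer
  have hQ' : (0 : ℝ) < Q := by exact_mod_cast hQ
  have hN : ∀ᶠ N in Filter.atTop, ∀ i, ‖(x i : X) - SchauderBasis.proj b N (x i)‖ <
      η / (2 * (k + 1)) := by
    refine Filter.eventually_all.2 fun i => ?_
    have := ((SchauderBasis.tendsto_proj b (x i : X)).const_sub (x i : X)).norm
    rw [sub_self, norm_zero] at this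
    exact this.eventually_lt_const (by positivity)
  obtain ⟨N, hN⟩ := hN.exists
  let A := (Finset.range N).filter (fun j => n ≤ j + 1)
  have hA : ∀ j ∈ A, n ≤ j + 1 := fun j hj => (Finset.mem_filter.1 hj).2
  have hA1 : ∀ j ∈ A, 1 ≤ j := fun j hj => by have := hA j hj; omega
  let z : Fin k → ℕ → ℝ := fun i j => b.coord j (x i : X)
  have hz : ∀ i, blockVec b (z i) A = SchauderBasis.proj b N (x i) := by
    intro i
    rw [SchauderBasis.proj_apply]
    refine Finset.sum_filter_of_ne fun j _ hj => ?_
    contrapose! hj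
    exact smul_eq_zero_of_left (hE _ (x i).2 j hj) _
  have hzD : ∀ i, ‖blockVec b (z i) A‖ ≤ D := by
    intro i
    have hD0 : 0 ≤ D := by
      by_contra hneg
      have := (norm_nonneg _).trans (hD ∅ (by simp) (b 0))
      have h0 : 0 < ‖b 0‖ := norm_pos_iff.2 (b.linearIndependent.ne_zero 0)
      nlinarith
    calc _ = ‖GeneralSchauderBasis.proj b A (x i : X)‖ := by
            rw [GeneralSchauderBasis.proj_apply]; rfl
      _ ≤ D * ‖(x i : X)‖ := hD A hA1 _
      _ ≤ D * 1 := by gcongr; exact hx1 i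
      _ = D := mul_one D
  -- `ρ` dominates every `z i`, so the ratios `z i j / ρ j` form a point of the cube `[-1, 1] ^ k`.
  -- Indices with the same rounding to the grid of step `1 / Q` form a block. Where `ρ j = 0` all `z
  -- i j` vanish and the label is harmless.
  let ρ : ℕ → ℝ := fun j => ∑ i, |z i j|
  have hρ0 : ∀ j, 0 ≤ ρ j := fun j => Finset.sum_nonneg fun i _ => abs_nonneg _
  have hzρ : ∀ i j, |z i j| ≤ ρ j := fun i j =>
    Finset.single_le_sum (f := fun i => |z i j|) (fun i _ => abs_nonneg _) (Finset.mem_univ i)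
  let s : ℕ → Fin k → ℤ := fun j i => ⌊Q * (z i j / ρ j)⌋
  have hρnorm : ‖blockVec b ρ A‖ ≤ 2 * C * D * k := by
    change ‖blockVec b (fun j => ∑ i, |z i j|) A‖ ≤ _
    rw [blockVec_sum b Finset.univ (fun i j => |z i j|)]
    calc _ ≤ ∑ _i : Fin k, 2 * C * D := norm_sum_le_of_le _ fun i _ => by
            refine (h.norm_blockVec_le_of_abs_le hC hA1 (a := z i) fun j _ => ?_).trans ?_
            · rw [abs_abs]
            · have := hzD i
              gcongr
      _ = _ := by simp; ring
  have hround : ∀ i j, |z i j - ρ j * (s j i / Q)| ≤ |(Q : ℝ)⁻¹ * ρ j| := by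
    intro i j
    rw [abs_of_nonneg (mul_nonneg (inv_nonneg.2 hQ'.le) (hρ0 j))]
    rcases (hρ0 j).eq_or_lt with h0 | h0
    · have := hzρ i j
      rw [← h0] at this ⊢
      simpa using this
    · have h1 : |Q * (z i j / ρ j) - s j i| ≤ 1 := by
        have h2 := Int.floor_le (Q * (z i j / ρ j))
        have h3 := Int.lt_floor_add_one (Q * (z i j / ρ j))
        rw [abs_le]
        constructor <;> simp only [s] <;> linarith
      have e : z i j - ρ j * (s j i / Q) = (Q * (z i j / ρ j) - s j i) * ((Q : ℝ)⁻¹ * ρ j) := by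
        field_simp
      rw [e, abs_mul, abs_of_pos (show 0 < (Q : ℝ)⁻¹ * ρ j by positivity)]
      exact mul_le_of_le_one_left (by positivity) h1
  -- The first term is truncation to `N` coordinates. Rounding errs by at most `ρ / Q`
  -- coordinatewise, hence by `2 * C / Q` times `‖blockVec b ρ A‖ ≤ 2 * C * D * k` in norm.
  have happrox : ∀ i, ‖(x i : X) - blockVec b (fun j => ρ j * (s j i / Q)) A‖ ≤
      η / (2 * (k + 1)) + 4 * C ^ 2 * D * k / Q := by
    intro i
    have h1 := h.norm_blockVec_le_of_abs_le hC hA1 (fun j _ => hround i j)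
    rw [blockVec_sub, blockVec_smul, norm_smul, norm_inv, Real.norm_of_nonneg hQ'.le, hz] at h1
    have h2 := (hN i).le
    refine (norm_sub_le_norm_sub_add_norm_sub _ (SchauderBasis.proj b N (x i)) _).trans ?_
    refine add_le_add h2 (h1.trans ?_)
    calc _ ≤ 2 * C * ((Q : ℝ)⁻¹ * (2 * C * D * k)) := by gcongr
      _ = _ := by ring
  refine ⟨A, ρ, s, hA, ?_, fun y hy => ?_⟩
  · calc _ ≤ (Fintype.piFinset fun _ : Fin k => Finset.Icc (-(Q : ℤ)) Q).card := by
            refine Finset.card_le_card fun σ hσ => ?_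
            obtain ⟨j, -, rfl⟩ := Finset.mem_image.1 hσ
            refine Fintype.mem_piFinset.2 fun i => ?_
            have h1 : |z i j / ρ j| ≤ 1 := by
              rw [abs_div, abs_of_nonneg (hρ0 j)]
              exact div_le_one_of_le₀ (hzρ i j) (hρ0 j)
            obtain ⟨h2, h3⟩ := abs_le.1 h1
            rw [Finset.mem_Icc]
            constructor
            · refine Int.le_floor.2 ?_
              push_cast
              nlinarith
            · refine Int.floor_le_iff.2 ?_
              push_cast
              nlinarith
      _ = _ := by
            simp only [Fintype.card_piFinset, Int.card_Icc, Finset.prod_const, Finset.card_univ,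
              Fintype.card_fin]
            congr 1
            omega
  · let r := x.repr ⟨y, hy⟩
    refine ⟨fun σ => ∑ i, r i * (σ i / Q), ?_⟩
    have e1 : y = ∑ i, r i • (x i : X) := by
      have := congrArg Subtype.val (x.sum_repr ⟨y, hy⟩)
      simp only [Submodule.coe_sum, Submodule.coe_smul] at this
      exact this.symm
    have e2 : blockVec b (fun j => ρ j * ∑ i, r i * (s j i / Q)) A =
        ∑ i, r i • blockVec b (fun j => ρ j * (s j i / Q)) A := by
      simp only [← blockVec_smul]
      rw [← blockVec_sum b Finset.univ (fun i j => r i * (ρ j * (s j i / Q)))]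
      congr 1
      ext j
      rw [Finset.mul_sum]
      exact Finset.sum_congr rfl fun i _ => by ring
    have e3 : y - blockVec b (fun j => ρ j * ∑ i, r i * (s j i / Q)) A =
        ∑ i, r i • ((x i : X) - blockVec b (fun j => ρ j * (s j i / Q)) A) := by
      rw [e2]
      simp only [smul_sub, Finset.sum_sub_distrib]
      rw [← e1]
    rw [e3]
    calc _ ≤ ∑ _i : Fin k, ‖y‖ * (η / (2 * (k + 1)) + 4 * C ^ 2 * D * k / Q) :=
          norm_sum_le_of_le _ fun i _ => by
            rw [norm_smul]
            exact mul_le_mul (hxr ⟨y, hy⟩ i) (happrox i) (norm_nonneg _) (norm_nonneg _)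
      _ = (k / (k + 1) * (η / 2) + 4 * C ^ 2 * D * k ^ 2 / Q) * ‖y‖ := by
          rw [Finset.sum_const, Finset.card_univ, Fintype.card_fin, nsmul_eq_mul]
          field_simp
      _ ≤ (1 * (η / 2) + η / 2) * ‖y‖ := by
          gcongr
          exact div_le_one_of_le₀ (by linarith) (by positivity)
      _ = η * ‖y‖ := by ring

/-! ### The operator attached to the blocks -/

/-- The operator `x ↦ (f_i (P_i x))_i`, with `P_i` the projection onto the `i`-th block and `f_i`
a norming functional of a fixed vector in that block. -/
theorem exists_operator_of_blocks {b : SchauderBasis ℝ X} {K D : ℝ} {n M : ℕ}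
    (hK0 : 0 ≤ K) (hD0 : 0 ≤ D) (h : IsPartitionL2 b n M K) (hn : 2 ≤ n)
    (hD : ∀ A : Finset ℕ, (∀ j ∈ A, 1 ≤ j) →
      ∀ x : X, ‖GeneralSchauderBasis.proj b A x‖ ≤ D * ‖x‖)
    {ι : Type} [DecidableEq ι] (A : Finset ℕ) (ρ : ℕ → ℝ) (s : ℕ → ι)
    (hA : ∀ j ∈ A, n ≤ j + 1) (hM : (A.image s).card ≤ M) :
    ∃ V : X →L[ℝ] EuclideanSpace ℝ (A.image s), (∀ x, ‖V x‖ ≤ K * D * ‖x‖) ∧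
      ∀ c : ι → ℝ, ‖blockVec b (fun j => ρ j * c (s j)) A‖ ≤
        K * ‖V (blockVec b (fun j => ρ j * c (s j)) A)‖ := by
  choose f hf1 hf using fun i => exists_dual_vector'' ℝ (blockVec b ρ (A.filter (s · = i)))
  let g : A.image s → X →L[ℝ] ℝ := fun i =>
    f i ∘L GeneralSchauderBasis.proj b (A.filter (s · = (i : ι)))
  let V : X →L[ℝ] EuclideanSpace ℝ (A.image s) :=
    ((EuclideanSpace.equiv (A.image s) ℝ).symm :
      (A.image s → ℝ) →L[ℝ] EuclideanSpace ℝ (A.image s)) ∘L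
      ContinuousLinearMap.pi g
  have hV : ∀ x, ‖V x‖ ^ 2 = ∑ i ∈ A.image s,
      f i (GeneralSchauderBasis.proj b (A.filter (s · = i)) x) ^ 2 := by
    intro x
    rw [EuclideanSpace.norm_sq_eq, ← Finset.sum_coe_sort (A.image s)
      (fun i => f i (GeneralSchauderBasis.proj b (A.filter (s · = i)) x) ^ 2)]
    refine Finset.sum_congr rfl fun i _ => ?_
    rw [Real.norm_eq_abs, sq_abs]
    rfl
  have hproj : ∀ x (B : Finset ℕ), GeneralSchauderBasis.proj b B x =
      blockVec b (fun j => b.coord j x) B := fun x B => GeneralSchauderBasis.proj_apply b B x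
  refine ⟨V, fun x => ?_, fun c => ?_⟩
  · refine le_of_sq_le_sq ?_ (by positivity)
    rw [hV]
    calc _ ≤ ∑ i ∈ A.image s, ‖blockVec b (fun j => b.coord j x) (A.filter (s · = i))‖ ^ 2 := by
            refine Finset.sum_le_sum fun i _ => ?_
            rw [← hproj, ← sq_abs, ← Real.norm_eq_abs]
            gcongr
            exact (f i).le_of_opNorm_le (hf1 i) _ |>.trans (one_mul _).le
      _ ≤ K ^ 2 * ‖blockVec b (fun j => b.coord j x) A‖ ^ 2 := (h ι _ A s hA hM).1
      _ ≤ K ^ 2 * (D * ‖x‖) ^ 2 := by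
            rw [← hproj]
            gcongr
            exact hD A (fun j hj => by have := hA j hj; omega) x
      _ = _ := by ring
  · refine le_of_sq_le_sq ((h ι _ A s hA hM).2.trans_eq ?_) (by positivity)
    rw [mul_pow, hV]
    congr 1
    refine Finset.sum_congr rfl fun i _ => ?_
    -- The factor `c ∘ s` is constant on a block, so the block is a multiple of the fixed vector
    -- normed by `f i`.
    have e1 : blockVec b (fun j => ρ j * c (s j)) (A.filter (s · = i)) =
        c i • blockVec b ρ (A.filter (s · = i)) := by
      rw [← blockVec_smul]
      refine Finset.sum_congr rfl fun j hj => ?_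
      simp only [(Finset.mem_filter.1 hj).2, mul_comm]
    have e2 : GeneralSchauderBasis.proj b (A.filter (s · = i))
        (blockVec b (fun j => ρ j * c (s j)) A) =
        blockVec b (fun j => ρ j * c (s j)) (A.filter (s · = i)) := by
      rw [hproj]
      refine Finset.sum_congr rfl fun j hj => ?_
      simp only [coord_blockVec, if_pos (Finset.mem_filter.1 hj).1]
    rw [e2, e1, map_smul, hf, norm_smul, smul_eq_mul, mul_pow, mul_pow, Real.norm_eq_abs, sq_abs]
    rfl

/-- For `x` in `E` and its block approximant `y`, both `‖x - y‖` and `K * ‖V (x - y)‖` are at most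
`‖x‖ / 4`. Together with `‖y‖ ≤ K * ‖V y‖` this yields `‖x‖ ≤ 2 * K * ‖V x‖`. -/
theorem euclideanDist_le_of_tail {b : SchauderBasis ℝ X} {C K D : ℝ} {n M Q : ℕ}
    (h : IsPartitionL2 b 2 2 C) (hC : 0 ≤ C) (hn : 2 ≤ n) (hQ : 0 < Q) (hD1 : 1 ≤ D) (hK1 : 1 ≤ K)
    (hD : ∀ A : Finset ℕ, (∀ j ∈ A, 1 ≤ j) →
      ∀ x : X, ‖GeneralSchauderBasis.proj b A x‖ ≤ D * ‖x‖)
    (hK : IsPartitionL2 b n M K)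
    (E : Submodule ℝ X) [FiniteDimensional ℝ E] (hE : ∀ x ∈ E, ∀ j, j + 1 < n → b.coord j x = 0)
    (hQη : 32 * C ^ 2 * K ^ 2 * D ^ 2 * Module.finrank ℝ E ^ 2 ≤ Q)
    (hM : (2 * Q + 1) ^ Module.finrank ℝ E ≤ M) :
    euclideanDist E ≤ ENNReal.ofReal (2 * K ^ 2 * D) ∧
      ∃ P : X →L[ℝ] E, (∀ y : E, P (y : X) = y) ∧ ‖P‖ ≤ 2 * K ^ 2 * D := by
  have hQ' : (0 : ℝ) < Q := by exact_mod_cast hQ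
  obtain ⟨A, ρ, s, hA, hcard, happ⟩ := exists_approx_by_blocks h hC hn hQ
    -- Since `‖V‖ ≤ K * D`, this `η` makes `K * ‖V‖ * η ≤ 1 / 4`; the factor `32` in the bound on
    -- `Q` comes from `η / 2`.
    (η := 1 / (4 * K ^ 2 * D)) (by positivity) hD E hE (by
      rw [div_div, div_le_div_iff₀ hQ' (by positivity)]
      linarith)
  obtain ⟨V, hV, hlow⟩ := exists_operator_of_blocks (by linarith) (by linarith) hK hn hD A ρ s hA
    (hcard.trans hM)
  have := euclideanDist_le_and_exists_projection V (α := K * D) (β := 2 * K) (by positivity)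
    (by positivity) hV E fun x hx => by
      obtain ⟨c, hc⟩ := happ x hx
      have h1 := hlow c
      set y := blockVec b (fun j => ρ j * c (s j)) A
      have h2 : ‖x‖ ≤ ‖x - y‖ + ‖y‖ := by simpa using norm_add_le (x - y) y
      have h3 : ‖V y‖ ≤ ‖V x‖ + ‖V (x - y)‖ := by
        rw [map_sub]
        have := norm_sub_le (V x) (V x - V y)
        rwa [sub_sub_cancel] at this
      have h4 : ‖V (x - y)‖ ≤ K * D * (1 / (4 * K ^ 2 * D) * ‖x‖) :=
        (hV _).trans (by gcongr)
      have h5 : K * (K * D * (1 / (4 * K ^ 2 * D) * ‖x‖)) = ‖x‖ / 4 := by field_simp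
      have h6 : 1 / (4 * K ^ 2 * D) ≤ 1 / 4 := by
        refine one_div_le_one_div_of_le (by norm_num) ?_
        nlinarith [one_le_pow₀ hK1 (n := 2)]
      have h7 : 1 / (4 * K ^ 2 * D) * ‖x‖ ≤ 1 / 4 * ‖x‖ := by gcongr
      have h8 : K * ‖V y‖ ≤ K * (‖V x‖ + K * D * (1 / (4 * K ^ 2 * D) * ‖x‖)) := by
        gcongr
        linarith
      rw [mul_add, h5] at h8
      linarith
  rwa [show K * D * (2 * K) = 2 * K ^ 2 * D by ring] at this

/-! ### Tails, lines and growth -/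

theorem IsAsymptoticL2DisjointWith.mono {b : SchauderBasis ℝ X} {C C' : ℝ}
    (h : IsAsymptoticL2DisjointWith b C) (hC : C ≤ C') : IsAsymptoticL2DisjointWith b C' := by
  intro n x hx hx'
  obtain ⟨A, B, hA, hB, hAB, h⟩ := h n x hx hx'
  exact ⟨A, B, hA, hB, hAB.trans hC, h⟩

/-- The vectors of `E` whose first `m` coordinates vanish form a subspace of codimension at most
`m` in `E`. -/
theorem exists_tail_subspace (b : SchauderBasis ℝ X) (E : Submodule ℝ X) [FiniteDimensional ℝ E]
    (m : ℕ) : ∃ F ≤ E, (∀ x ∈ F, ∀ j < m, b.coord j x = 0) ∧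
      Module.finrank ℝ E ≤ m + Module.finrank ℝ F := by
  let Φ : E →ₗ[ℝ] Fin m → ℝ :=
    LinearMap.pi fun j => (b.coord j : X →ₗ[ℝ] ℝ).domRestrict E
  refine ⟨(LinearMap.ker Φ).map E.subtype, Submodule.map_subtype_le _ _, ?_, ?_⟩
  · rintro _ ⟨x, hx, rfl⟩ j hj
    exact congrFun (LinearMap.mem_ker.1 hx) ⟨j, hj⟩
  · rw [Submodule.finrank_map_subtype_eq, ← Φ.finrank_range_add_finrank_ker]
    gcongr
    simpa using Submodule.finrank_le (LinearMap.range Φ)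

/-- A norming functional of `x` serves as the operator into the Hilbert space `ℝ`. -/
theorem exists_euclidean_complemented_line {E : Submodule ℝ X} {x : X} (hxE : x ∈ E)
    (hx : x ≠ 0) : ∃ F ≤ E, Module.finrank ℝ F = 1 ∧ euclideanDist F ≤ 1 ∧
      ∃ P : X →L[ℝ] F, (∀ y : F, P (y : X) = y) ∧ ‖P‖ ≤ 1 := by
  obtain ⟨f, hf1, hf⟩ := exists_dual_vector'' ℝ x
  have := euclideanDist_le_and_exists_projection f zero_le_one zero_le_one
    (fun y => f.le_of_opNorm_le hf1 y) (Submodule.span ℝ {x}) fun y hy => by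
      obtain ⟨t, rfl⟩ := Submodule.mem_span_singleton.1 hy
      rw [map_smul, hf, norm_smul, norm_smul]
      simp
  rw [one_mul, ENNReal.ofReal_one] at this
  exact ⟨_, (Submodule.span_singleton_le_iff_mem _ _).2 hxE, finrank_span_singleton hx, this⟩

/-- Polynomial growth is dominated by exponential growth, doubly so in the exponent. -/
theorem exists_forall_pow_le_two_pow_two_pow (c : ℕ) : ∃ m₀ ≥ 1, ∀ m ≥ m₀, ∀ k ≤ 2 * m + 1,
    (2 * (c * (k + 1) ^ 2) + 1) ^ k ≤ 2 ^ (2 ^ m - 1) := by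
  have hlim := tendsto_pow_const_div_const_pow_of_one_lt 2 (one_lt_two : (1 : ℝ) < 2)
  obtain ⟨m₁, hm₁⟩ := Filter.eventually_atTop.1
    (hlim.eventually_lt_const (show (0 : ℝ) < 1 / (32 * c + 4) by positivity))
  refine ⟨max m₁ 1, le_max_right _ _, fun m hm k hk => ?_⟩
  have hm1 : 1 ≤ m := (le_max_right _ _).trans hm
  -- The term `32 * c` bounds the base by `2 ^ m`; the term `4` gives `m * k ≤ 3 * m ^ 2 < 2 ^ m`
  -- for the exponent.
  have h1 : (32 * c + 4) * m ^ 2 ≤ 2 ^ m := by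
    have := hm₁ m ((le_max_left _ _).trans hm)
    rw [div_lt_div_iff₀ (by positivity) (by positivity)] at this
    have h2 : (((32 * c + 4) * m ^ 2 : ℕ) : ℝ) ≤ ((2 ^ m : ℕ) : ℝ) := by
      push_cast
      linarith
    exact_mod_cast h2
  have hsq : (k + 1) ^ 2 ≤ 16 * m ^ 2 := by
    calc (k + 1) ^ 2 ≤ (4 * m) ^ 2 := Nat.pow_le_pow_left (by omega) 2
      _ = _ := by ring
  have hm2 : 1 ≤ m ^ 2 := Nat.one_le_pow _ _ hm1
  have hbase : 2 * (c * (k + 1) ^ 2) + 1 ≤ 2 ^ m := by nlinarith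
  have hexp : m * k ≤ 2 ^ m - 1 := by
    refine Nat.le_sub_one_of_lt ?_
    nlinarith
  calc _ ≤ (2 ^ m) ^ k := Nat.pow_le_pow_left hbase k
    _ = 2 ^ (m * k) := (pow_mul _ _ _).symm
    _ ≤ _ := Nat.pow_le_pow_right (by norm_num) hexp

end WeakHilbert

theorem theorem3p1 {X : Type*} [NormedAddCommGroup X] [NormedSpace ℝ X] [CompleteSpace X]
    (b : SchauderBasis ℝ X) (hX : WeakHilbert.IsAsymptoticL2Disjoint b) :
    WeakHilbert.IsWeakHilbert X := by
  open WeakHilbert in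
  obtain ⟨C₀, -, hC₀⟩ := hX
  have hC := hC₀.mono (le_max_left C₀ 1)
  have hC1 : 1 ≤ max C₀ 1 := le_max_right _ _
  generalize max C₀ 1 = C at hC hC1
  have hU : IsPartitionL2 b 2 2 C := hC.isPartitionL2 2
  obtain ⟨D, hD1, hD⟩ := hU.exists_norm_proj_le (by linarith)
  have hK1 : 1 ≤ C ^ 3 := one_le_pow₀ hC1
  obtain ⟨c, hc⟩ := exists_nat_ge (32 * C ^ 2 * (C ^ 3) ^ 2 * D ^ 2)
  have hc0 : 0 < c := by
    have : (0 : ℝ) < c := lt_of_lt_of_le (by positivity) hc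
    exact_mod_cast this
  obtain ⟨m₀, hm₀, hgrowth⟩ := exists_forall_pow_le_two_pow_two_pow c
  have hm₀' : (1 : ℝ) ≤ m₀ := by exact_mod_cast hm₀
  have hconst : 1 ≤ 2 * (C ^ 3) ^ 2 * D := by nlinarith [one_le_pow₀ hK1 (n := 2)]
  refine ⟨1 / (2 * m₀), 2 * (C ^ 3) ^ 2 * D, by positivity, hconst, fun E _ => ?_⟩
  -- If `dim E / 2 < m₀`, then `dim E ≤ 2 * m₀`, so a line already has proportion `1 / (2 * m₀)`.
  rcases lt_or_ge (Module.finrank ℝ E / 2) m₀ with hsmall | hlarge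
  · by_cases hbot : E = ⊥
    · subst hbot
      have := euclideanDist_le_and_exists_projection (0 : X →L[ℝ] ℝ) (α := 2 * (C ^ 3) ^ 2 * D)
        (β := 1) (by linarith) zero_le_one (fun x => by simp; positivity) ⊥ fun x hx => by
          simp [(Submodule.mem_bot ℝ).1 hx]
      rw [mul_one] at this
      exact ⟨⊥, le_rfl, by simp, this⟩
    · obtain ⟨x, hxE, hx⟩ := Submodule.exists_mem_ne_zero_of_ne_bot hbot
      obtain ⟨F, hFE, hF, hdist, P, hP, hPnorm⟩ := exists_euclidean_complemented_line hxE hx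
      refine ⟨F, hFE, ?_, hdist.trans ?_, P, hP, hPnorm.trans hconst⟩
      · have h1 : (Module.finrank ℝ E : ℝ) ≤ 2 * m₀ := by
          have : Module.finrank ℝ E ≤ 2 * m₀ := by omega
          exact_mod_cast this
        rw [hF, Nat.cast_one, one_div_mul_eq_div]
        exact div_le_one_of_le₀ h1 (by positivity)
      · rw [← ENNReal.ofReal_one]
        exact ENNReal.ofReal_le_ofReal hconst
  · obtain ⟨F, hFE, hF, hdim⟩ := exists_tail_subspace b E (Module.finrank ℝ E / 2)
    have hfin : FiniteDimensional ℝ F := Submodule.finiteDimensional_of_le hFE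
    have hFdim : Module.finrank ℝ F ≤ Module.finrank ℝ E := Submodule.finrank_mono hFE
    set m := Module.finrank ℝ E / 2 with hm
    have hK := hC.isPartitionL2_exp_exp (n := m + 1) (by omega)
    rw [Nat.add_sub_cancel] at hK
    -- The `+ 1` keeps `Q` positive whatever the dimension of `F`, which is at most `2 * m + 1`.
    refine ⟨F, hFE, ?_, euclideanDist_le_of_tail (Q := c * (Module.finrank ℝ F + 1) ^ 2) hU
      (by linarith) (by omega) (by positivity) hD1 hK1 hD hK F
      (fun x hx j hj => hF x hx j (by omega)) ?_ (hgrowth m hlarge _ (by omega))⟩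
    · have h1 : (Module.finrank ℝ E : ℝ) ≤ 2 * Module.finrank ℝ F := by
        have : Module.finrank ℝ E ≤ 2 * Module.finrank ℝ F := by omega
        exact_mod_cast this
      rw [one_div_mul_eq_div, div_le_iff₀ (by positivity)]
      nlinarith [(Nat.cast_nonneg (Module.finrank ℝ F) : (0 : ℝ) ≤ Module.finrank ℝ F)]
    · push_cast
      gcongr
      linarith
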